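/- Let $S$ be a semigroup with zero. A (right) $0$-module over $S$ is an abelian group $A$ with a multiplication $A\times (S\setminus 0)\to A$ such that $(a+b)s=as+bs$ for all $a,b\in A$, $s\in S\setminus 0$, and $(as)t=a(st)$ for all $a\in A$ and $s,t\in S\setminus 0$ with $st\neq 0$. For such $A$ let $C_0^0(S,A)=A$ and, for $n\ge 1$, let $C_n^0(S,A)$ be the group of finite formal sums of symbols $a[s_1,\dots,s_n]$ ($a\in A$, $s_i\in S$, $s_1s_2\cdots s_n\ne 0$), additive in $a$. Let $\partial_n:C_n^0(S,A)\to C_{n-1}^0(S,A)$ be the homomorphism with $\partial_1(a[s])=as-a$ and, for $n\ge 2$, $$\partial_n(a[s_1,\dots,s_n])=as_1[s_2,\dots,s_n]+\sum_{i=1}^{n-1}(-1)^i a[s_1,\dots,s_is_{i+1},\dots,s_n]+(-1)^n a[s_1,\dots,s_{n-1}],$$ and put $H_n^0(S,A)=\operatorname{Ker}\partial_n/\operatorname{Im}\partial_{n+1}$ for $n\ge 1$. **Proposition.** Suppose that $S$ is given, as a semigroup with zero, by generators $a_i$ $(i\in I)$ and defining relations all of which are of the form $a_ia_j=0$, that is,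 $S=\langle a_i\ (i\in I)\mid a_ia_j=0 \text{ for } (i,j)\in\Gamma\rangle$ for some $\Gamma\subseteq I\times I$. Then $H_n^0(S,A)=0$ for all $n>1$ and every $0$-module $A$ over $S$. -/

import Mathlib

/-! ### Presentations of semigroups with zero -/

/-- The value in `S` of a word over the alphabet `ι` (or of the symbol `0`) when the letter `i`
is interpreted as `a i`. -/
def wordValue {ι S : Type*} [SemigroupWithZero S] (a : ι → S) : WithZero (FreeSemigroup ι) → S :=
  WithZero.recZeroCoe 0 (fun w => FreeSemigroup.lift a w)

/-- The semigroup with zero `S` is given by the generators `a i` and the defining relations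
`u = v`, `R u v`: the `a i` generate `S` (together with `0`), and an equality between two
words (or between a word and `0`) holds in `S` exactly when it is a consequence of the defining
relations, i.e. lies in the least congruence containing them. -/
structure IsZeroPresentation {ι S : Type*} [SemigroupWithZero S] (a : ι → S)
    (R : WithZero (FreeSemigroup ι) → WithZero (FreeSemigroup ι) → Prop) : Prop where
  surjective : Function.Surjective (wordValue a)
  eq_iff : ∀ u v, wordValue a u = wordValue a v ↔ conGen R u v

/-- The relations `a_i a_j = 0` for `(i, j) ∈ Γ`. -/
inductive ZeroProductRel {ι : Type*} (Γ : Set (ι × ι)) :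
    WithZero (FreeSemigroup ι) → WithZero (FreeSemigroup ι) → Prop
  | rel (i j : ι) (h : (i, j) ∈ Γ) :
      ZeroProductRel Γ ((FreeSemigroup.of i * FreeSemigroup.of j : FreeSemigroup ι)) 0

/-! ### Zero-modules -/

/-- A (right) 0-module over a semigroup `S` with zero: an abelian group `A` with a multiplication
`A × (S \ 0) → A`, additive in `A`, with `(a s) t = a (s t)` whenever `s t ≠ 0`. -/
class ZeroModule (S A : Type*) [SemigroupWithZero S] [AddCommGroup A] where
  act : A → {s : S // s ≠ 0} → A
  add_act : ∀ (a b : A) (s : {s : S // s ≠ 0}), act (a + b) s = act a s + act b s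
  act_act : ∀ (a : A) (s t : {s : S // s ≠ 0}) (h : s.1 * t.1 ≠ 0),
    act (act a s) t = act a ⟨s.1 * t.1, h⟩

/-- The additive endomorphism `a ↦ a s`. -/
def ZeroModule.actHom {S : Type*} (A : Type*) [SemigroupWithZero S] [AddCommGroup A]
    [ZeroModule S A] (s : {s : S // s ≠ 0}) : A →+ A :=
  AddMonoidHom.mk' (fun a => ZeroModule.act a s) (fun a b => ZeroModule.add_act a b s)

/-! ### Tuples with nonzero product -/

/-- The product `s_1 ⋯ s_n`; it is taken in `S` with an identity adjoined so that the
empty product makes sense (it is then the adjoined identity). -/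
def tupleProd {S : Type*} [SemigroupWithZero S] {n : ℕ} (s : Fin n → S) : WithOne S :=
  (List.ofFn fun i => (s i : WithOne S)).prod

/-- The set `D_n` of `n`-tuples `[s_1, …, s_n]` with `s_1 ⋯ s_n ≠ 0`; `D_0` consists of
the empty tuple. -/
def NonzeroTuple (S : Type*) [SemigroupWithZero S] (n : ℕ) : Type _ :=
  {s : Fin n → S // tupleProd s ≠ ((0 : S) : WithOne S)}

section TupleLemmas

variable {S : Type*} [SemigroupWithZero S]

theorem withOne_coe_zero_mul' (x : WithOne S) : ((0 : S) : WithOne S) * x = ((0 : S) : WithOne S) := by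
  cases x with
  | one => exact mul_one _
  | coe x => rw [← WithOne.coe_mul, zero_mul]

theorem withOne_mul_coe_zero' (x : WithOne S) : x * ((0 : S) : WithOne S) = ((0 : S) : WithOne S) := by
  cases x with
  | one => exact one_mul _
  | coe x => rw [← WithOne.coe_mul, mul_zero]

theorem tupleProd_succ {n : ℕ} (s : Fin (n + 1) → S) :
    tupleProd s = (s 0 : WithOne S) * tupleProd (Fin.tail s) := by
  simp [tupleProd, List.ofFn_succ, Fin.tail]

theorem tupleProd_succ' {n : ℕ} (s : Fin (n + 1) → S) :
    tupleProd s = tupleProd (Fin.init s) * (s (Fin.last n) : WithOne S) := by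
  unfold tupleProd
  rw [List.ofFn_succ_last, List.prod_append]
  simp [Fin.init]

theorem tupleProd_contractNth {n : ℕ} (s : Fin (n + 1) → S) (j : Fin n) :
    tupleProd (Fin.contractNth j.castSucc (· * ·) s) = tupleProd s := by
  induction n with
  | zero => exact j.elim0
  | succ n ih =>
    rw [tupleProd_succ, tupleProd_succ s]
    refine Fin.cases ?_ (fun j => ?_) j
    · rw [tupleProd_succ (Fin.tail s), ← mul_assoc, ← WithOne.coe_mul]
      rfl
    · rw [← ih (Fin.tail s) j]
      congr 2
      funext k
      simp [Fin.tail, Fin.contractNth]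

end TupleLemmas

namespace NonzeroTuple

variable {S : Type*} [SemigroupWithZero S] {n : ℕ}

/-- The first entry `s_1`, a nonzero element of `S`. -/
def head (s : NonzeroTuple S (n + 1)) : {x : S // x ≠ 0} :=
  ⟨s.1 0, fun h => s.2 (by rw [tupleProd_succ, h, withOne_coe_zero_mul'])⟩

/-- `[s_1, …, s_{n+1}] ↦ [s_2, …, s_{n+1}]`. -/
def tail (s : NonzeroTuple S (n + 1)) : NonzeroTuple S n :=
  ⟨Fin.tail s.1, fun h => s.2 (by rw [tupleProd_succ, h, withOne_mul_coe_zero'])⟩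

/-- `[s_1, …, s_{n+1}] ↦ [s_1, …, s_n]`. -/
def init (s : NonzeroTuple S (n + 1)) : NonzeroTuple S n :=
  ⟨Fin.init s.1, fun h => s.2 (by rw [tupleProd_succ', h, withOne_coe_zero_mul'])⟩

/-- `[s_1, …, s_{n+1}] ↦ [s_1, …, s_i s_{i+1}, …, s_{n+1}]`, where `i = j + 1`
(the entries are numbered from `1` and `j : Fin n` from `0`). -/
def contract (s : NonzeroTuple S (n + 1)) (j : Fin n) : NonzeroTuple S n :=
  ⟨Fin.contractNth j.castSucc (· * ·) s.1, by rw [tupleProd_contractNth]; exact s.2⟩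

end NonzeroTuple

/-! ### The complex of 0-chains and its homology -/

/-- The group `C_n^0(S, A)` of 0-chains: finite formal sums `∑ a_{s_1, …, s_n} [s_1, …, s_n]` over
`D_n` with coefficients in `A`. As `D_0` has one element, the empty tuple, `C_0^0(S, A)`
is `A`. -/
abbrev ZeroChain (S A : Type*) [SemigroupWithZero S] [AddCommGroup A] (n : ℕ) : Type _ :=
  NonzeroTuple S n →₀ A

/-- The boundary `∂_{n+1} : C_{n+1}^0(S, A) → C_n^0(S, A)`,
`a [s_1, …, s_{n+1}] ↦ a s_1 [s_2, …, s_{n+1}] + ∑_{i=1}^{n} (-1)^i a [s_1, …, s_i s_{i+1}, …, s_{n+1}]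
  + (-1)^{n+1} a [s_1, …, s_n]`. For `n = 0` this is `a [s] ↦ a s - a`. -/
noncomputable def zeroBoundary (S A : Type*) [SemigroupWithZero S] [AddCommGroup A]
    [ZeroModule S A] (n : ℕ) : ZeroChain S A (n + 1) →+ ZeroChain S A n :=
  Finsupp.liftAddHom fun s =>
    (Finsupp.singleAddHom s.tail : A →+ ZeroChain S A n).comp (ZeroModule.actHom A s.head)
      + ∑ j : Fin n, (-1 : ℤ) ^ ((j : ℕ) + 1) •
          (Finsupp.singleAddHom (s.contract j) : A →+ ZeroChain S A n)
      + (-1 : ℤ) ^ (n + 1) • (Finsupp.singleAddHom s.init : A →+ ZeroChain S A n)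

theorem zeroBoundary_single {S A : Type*} [SemigroupWithZero S] [AddCommGroup A]
    [ZeroModule S A] (n : ℕ) (s : NonzeroTuple S (n + 1)) (a : A) :
    zeroBoundary S A n (Finsupp.single s a) =
      Finsupp.single s.tail (ZeroModule.act a s.head)
        + ∑ j : Fin n, (-1 : ℤ) ^ ((j : ℕ) + 1) • Finsupp.single (s.contract j) a
        + (-1 : ℤ) ^ (n + 1) • Finsupp.single s.init a := by
  rw [zeroBoundary, Finsupp.liftAddHom_apply_single]
  simp [ZeroModule.actHom, AddMonoidHom.finsetSum_apply]

/-- The cycles: `Ker ∂_n` for `n ≥ 1`, and all of `C_0^0(S, A) = A` for `n = 0`. -/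
noncomputable def zeroCycles (S A : Type*) [SemigroupWithZero S] [AddCommGroup A]
    [ZeroModule S A] : (n : ℕ) → AddSubgroup (ZeroChain S A n)
  | 0 => ⊤
  | n + 1 => (zeroBoundary S A n).ker

/-- The boundaries `Im ∂_{n+1}`. -/
noncomputable def zeroBoundaries (S A : Type*) [SemigroupWithZero S] [AddCommGroup A]
    [ZeroModule S A] (n : ℕ) : AddSubgroup (ZeroChain S A n) :=
  (zeroBoundary S A n).range

/-- The 0-homology group `H_n^0(S, A) = Ker ∂_n / Im ∂_{n+1}`. -/
abbrev ZeroHomology (S A : Type*) [SemigroupWithZero S] [AddCommGroup A]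
    [ZeroModule S A] (n : ℕ) : Type _ :=
  zeroCycles S A n ⧸ (zeroBoundaries S A n).addSubgroupOf (zeroCycles S A n)

/-! ### Unique factorization of the nonzero elements -/

/-! The relations only send words to `0`, so they never identify two distinct words of nonzero
value: each nonzero element of `S` is the value of exactly one word, and its indecomposable factors
are the letters (`IsZeroPresentation.isZeroFree`). As for free semigroups, this gives a contracting
homotopy `h`. For `s = x_1 ⋯ x_k` with indecomposable `x_i`, let `h (c [s, r])` be minus the sum
over `i < k` of `c x_1 ⋯ x_{i-1} [x_i, x_{i+1} ⋯ x_k, r]`. Then `∂ h + h ∂ = id` in degrees at least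
`2` (`homotopy_barSymbol`, by induction on the length of `s`), so a cycle `z` equals `∂ (h z)`.
Degree `1` is excluded: the identity needs a second entry to merge with the first. -/

/-- A nonzero element which is not a product of two elements. -/
def IsIndecomposable {S : Type*} [SemigroupWithZero S] (x : S) : Prop :=
  x ≠ 0 ∧ ∀ u v : S, x ≠ u * v

/-- Every nonzero element of `S` is indecomposable or has a unique indecomposable left factor with
unique cofactor, and splitting off that factor decreases the length. -/
structure IsZeroFree {S : Type*} [SemigroupWithZero S] (len : S → ℕ) : Prop where
  exists_split : ∀ s : S, s ≠ 0 → ¬ IsIndecomposable s →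
    ∃ x t : S, IsIndecomposable x ∧ s = x * t ∧ len t < len s
  split_unique : ∀ x y t u : S, IsIndecomposable x → IsIndecomposable y → x * t = y * u →
    x * t ≠ 0 → x = y ∧ t = u

theorem left_ne_zero_of_mul' {S : Type*} [SemigroupWithZero S] {x y : S} (h : x * y ≠ 0) :
    x ≠ 0 := fun h' => h (by rw [h', zero_mul])

theorem right_ne_zero_of_mul' {S : Type*} [SemigroupWithZero S] {x y : S} (h : x * y ≠ 0) :
    y ≠ 0 := fun h' => h (by rw [h', mul_zero])

/-! ### Words in the generators and their values -/

section Presentation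

variable {ι S : Type*} [SemigroupWithZero S] {a : ι → S}

theorem wordValue_mul (u v : WithZero (FreeSemigroup ι)) :
    wordValue a (u * v) = wordValue a u * wordValue a v := by
  induction u with
  | zero => rw [zero_mul]; exact (zero_mul _).symm
  | coe u =>
    induction v with
    | zero => rw [mul_zero]; exact (mul_zero _).symm
    | coe v => exact map_mul (FreeSemigroup.lift a) u v

/-- Two words are congruent when they are equal or both have value `0`. -/
def equalOrZeroCon (a : ι → S) : Con (WithZero (FreeSemigroup ι)) where
  r u v := u = v ∨ (wordValue a u = 0 ∧ wordValue a v = 0)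
  iseqv :=
    { refl := fun _ => Or.inl rfl
      symm := by
        rintro u v (h | ⟨h, h'⟩)
        · exact Or.inl h.symm
        · exact Or.inr ⟨h', h⟩
      trans := by
        rintro u v w (rfl | ⟨h, h'⟩) (rfl | ⟨k, k'⟩)
        · exact Or.inl rfl
        · exact Or.inr ⟨k, k'⟩
        · exact Or.inr ⟨h, h'⟩
        · exact Or.inr ⟨h, k'⟩ }
  mul' := by
    rintro u v w z (rfl | ⟨h, h'⟩) (rfl | ⟨k, k'⟩)
    · exact Or.inl rfl
    · exact Or.inr (by simp [wordValue_mul, k, k'])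
    · exact Or.inr (by simp [wordValue_mul, h, h'])
    · exact Or.inr (by simp [wordValue_mul, h, h'])

variable {Γ : Set (ι × ι)}

/-- Both sides of every defining relation have value `0`, so `equalOrZeroCon` contains the relations
and hence the congruence they generate. -/
theorem IsZeroPresentation.lift_injective_of_ne_zero
    (hS : IsZeroPresentation a (ZeroProductRel Γ)) {u v : FreeSemigroup ι}
    (h : FreeSemigroup.lift a u = FreeSemigroup.lift a v) (h0 : FreeSemigroup.lift a u ≠ 0) :
    u = v := by
  have hle : conGen (ZeroProductRel Γ) ≤ equalOrZeroCon a := by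
    refine Con.conGen_le.2 ?_
    rintro _ _ ⟨i, j, hij⟩
    exact Or.inr ⟨(hS.eq_iff _ 0).2 (ConGen.Rel.of _ _ (.rel i j hij)), rfl⟩
  rcases hle ((hS.eq_iff (u : WithZero (FreeSemigroup ι)) v).1 h) with h | ⟨h, -⟩
  · exact WithZero.coe_injective h
  · exact absurd h h0

theorem IsZeroPresentation.exists_word (hS : IsZeroPresentation a (ZeroProductRel Γ)) {s : S}
    (hs : s ≠ 0) : ∃ w : FreeSemigroup ι, FreeSemigroup.lift a w = s := by
  obtain ⟨w, rfl⟩ := hS.surjective s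
  induction w with
  | zero => exact absurd rfl hs
  | coe w => exact ⟨w, rfl⟩

theorem IsZeroPresentation.isIndecomposable_of (hS : IsZeroPresentation a (ZeroProductRel Γ))
    {i : ι} (hi : a i ≠ 0) : IsIndecomposable (a i) := by
  refine ⟨hi, fun u v h => ?_⟩
  obtain ⟨p, rfl⟩ := hS.exists_word (left_ne_zero_of_mul' (h ▸ hi))
  obtain ⟨q, rfl⟩ := hS.exists_word (right_ne_zero_of_mul' (h ▸ hi))
  -- A word of length one would equal a concatenation of two nonempty words.
  have := hS.lift_injective_of_ne_zero (u := .of i) (v := p * q)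
    (by rw [map_mul]; exact h) hi
  have := congrArg FreeSemigroup.length this
  have hp : 0 < p.length := Nat.succ_pos _
  have hq : 0 < q.length := Nat.succ_pos _
  simp at this
  omega

theorem IsZeroPresentation.exists_generator_eq (hS : IsZeroPresentation a (ZeroProductRel Γ))
    {x : S} (hx : IsIndecomposable x) : ∃ i, a i = x := by
  obtain ⟨w, rfl⟩ := hS.exists_word hx.1
  induction w using FreeSemigroup.recOnMul with
  | ih1 i => exact ⟨i, rfl⟩
  | ih2 i w _ _ => exact absurd (map_mul _ _ _) (hx.2 _ _)

/-- The length of a word of value `s`. -/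
noncomputable def wordLength (a : ι → S) (s : S) : ℕ :=
  open Classical in
  if h : ∃ w : FreeSemigroup ι, FreeSemigroup.lift a w = s then h.choose.length else 0

theorem IsZeroPresentation.wordLength_lift (hS : IsZeroPresentation a (ZeroProductRel Γ))
    {w : FreeSemigroup ι} (hw : FreeSemigroup.lift a w ≠ 0) :
    wordLength a (FreeSemigroup.lift a w) = w.length := by
  have h : ∃ v : FreeSemigroup ι, FreeSemigroup.lift a v = FreeSemigroup.lift a w := ⟨w, rfl⟩
  rw [wordLength, dif_pos h, ← hS.lift_injective_of_ne_zero h.choose_spec.symm hw]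

/-- The indecomposable left factor is the first letter of the representing word and the cofactor is
the value of the rest; uniqueness of the word determines both. -/
theorem IsZeroPresentation.isZeroFree (hS : IsZeroPresentation a (ZeroProductRel Γ)) :
    IsZeroFree (wordLength a) where
  exists_split s hs hi := by
    obtain ⟨w, rfl⟩ := hS.exists_word hs
    induction w using FreeSemigroup.recOnMul with
    | ih1 i => exact absurd (hS.isIndecomposable_of hs) hi
    | ih2 i w _ _ =>
      have hs' := hs
      rw [map_mul] at hs'
      refine ⟨a i, FreeSemigroup.lift a w,
        hS.isIndecomposable_of (left_ne_zero_of_mul' hs'), map_mul _ _ _, ?_⟩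
      rw [hS.wordLength_lift hs, hS.wordLength_lift (right_ne_zero_of_mul' hs')]
      simp
  split_unique x y t u hx hy h h0 := by
    obtain ⟨i, rfl⟩ := hS.exists_generator_eq hx
    obtain ⟨j, rfl⟩ := hS.exists_generator_eq hy
    obtain ⟨p, rfl⟩ := hS.exists_word (right_ne_zero_of_mul' h0)
    obtain ⟨q, rfl⟩ := hS.exists_word (right_ne_zero_of_mul' (h ▸ h0))
    have := hS.lift_injective_of_ne_zero (u := .of i * p) (v := .of j * q)
      (by rw [map_mul, map_mul]; exact h) (by rw [map_mul]; exact h0)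
    have h1 : i = j := congrArg FreeSemigroup.head this
    have h2 := congrArg FreeSemigroup.tail this
    simp only [FreeSemigroup.tail_mul, FreeSemigroup.of_tail, List.nil_append] at h2
    injection h2 with h2 h3
    exact ⟨by rw [h1], by rw [FreeSemigroup.ext h2 h3]⟩

end Presentation

/-! ### The boundary on total symbols -/

section Homotopy

variable {S A : Type*} [SemigroupWithZero S] [AddCommGroup A]

theorem tupleProd_cons {n : ℕ} (x : S) (r : Fin n → S) :
    tupleProd (Fin.cons x r : Fin (n + 1) → S) = (x : WithOne S) * tupleProd r := by
  rw [tupleProd_succ, Fin.cons_zero, Fin.tail_cons]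

theorem tupleProd_cons_mul {n : ℕ} (x y : S) (r : Fin n → S) :
    tupleProd (Fin.cons (x * y) r : Fin (n + 1) → S) =
      tupleProd (Fin.cons x (Fin.cons y r : Fin (n + 1) → S) : Fin (n + 2) → S) := by
  simp only [tupleProd_cons, WithOne.coe_mul, mul_assoc]

theorem left_ne_zero_of_withOne_mul {x y : WithOne S} (h : x * y ≠ ((0 : S) : WithOne S)) :
    x ≠ ((0 : S) : WithOne S) := fun h' => h (by rw [h', withOne_coe_zero_mul'])

theorem right_ne_zero_of_withOne_mul {x y : WithOne S} (h : x * y ≠ ((0 : S) : WithOne S)) :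
    y ≠ ((0 : S) : WithOne S) := fun h' => h (by rw [h', withOne_mul_coe_zero'])

/-- The tuple with entries `s_1, …, s_n`, as an element of `D_n`. -/
def NonzeroTuple.ofNe {n : ℕ} (s : Fin n → S) (h : tupleProd s ≠ ((0 : S) : WithOne S)) :
    NonzeroTuple S n := ⟨s, h⟩

variable (A) in
/-- The symbol `c [s_1, …, s_n]`, which is `0` if `s_1 ⋯ s_n = 0`. -/
noncomputable def barSymbol {n : ℕ} (s : Fin n → S) : A →+ ZeroChain S A n :=
  open Classical in
  if h : tupleProd s ≠ ((0 : S) : WithOne S) then Finsupp.singleAddHom (.ofNe s h) else 0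

theorem barSymbol_of_ne {n : ℕ} {s : Fin n → S} (h : tupleProd s ≠ ((0 : S) : WithOne S)) (c : A) :
    barSymbol A s c = Finsupp.single (.ofNe s h) c := by
  rw [barSymbol, dif_pos h]; rfl

theorem barSymbol_eq_single {n : ℕ} (s : NonzeroTuple S n) (c : A) :
    Finsupp.single s c = barSymbol A s.1 c := (barSymbol_of_ne s.2 c).symm

/-- The alternating sum of the values of `f` at the inner contractions of `r` and at the tuple `r`
without its last entry. -/
def innerFaces {M : Type*} [AddCommGroup M] {n : ℕ} (f : (Fin n → S) → M) (r : Fin (n + 1) → S) :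
    M :=
  ∑ j : Fin n, (-1 : ℤ) ^ ((j : ℕ) + 1) • f (Fin.contractNth j.castSucc (· * ·) r)
    + (-1 : ℤ) ^ (n + 1) • f (Fin.init r)

/-- Contracting or truncating `r` keeps the product with `x` in front nonzero, so `f` and `g` need
only agree on such tuples. -/
theorem innerFaces_congr {M : Type*} [AddCommGroup M] {n : ℕ} {f g : (Fin n → S) → M} {x : S}
    {r : Fin (n + 1) → S}
    (hr : tupleProd (Fin.cons x r : Fin (n + 2) → S) ≠ ((0 : S) : WithOne S))
    (h : ∀ q, tupleProd (Fin.cons x q : Fin (n + 1) → S) ≠ ((0 : S) : WithOne S) → f q = g q) :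
    innerFaces f r = innerFaces g r := by
  rw [tupleProd_cons] at hr
  unfold innerFaces
  congr 1
  · refine Finset.sum_congr rfl fun j _ => ?_
    rw [h]
    rwa [tupleProd_cons, tupleProd_contractNth]
  · rw [h]
    rw [tupleProd_succ', ← mul_assoc] at hr
    rw [tupleProd_cons]
    exact left_ne_zero_of_withOne_mul hr

theorem innerFaces_add {M : Type*} [AddCommGroup M] {n : ℕ} (f g : (Fin n → S) → M)
    (r : Fin (n + 1) → S) :
    innerFaces (fun q => f q + g q) r = innerFaces f r + innerFaces g r := by
  simp only [innerFaces, smul_add, Finset.sum_add_distrib]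
  abel

theorem innerFaces_neg {M : Type*} [AddCommGroup M] {n : ℕ} (f : (Fin n → S) → M)
    (r : Fin (n + 1) → S) :
    innerFaces (fun q => - f q) r = - innerFaces f r := by
  simp only [innerFaces, smul_neg, Finset.sum_neg_distrib]
  abel

theorem innerFaces_zero {M : Type*} [AddCommGroup M] {n : ℕ} (r : Fin (n + 1) → S) :
    innerFaces (fun _ => (0 : M)) r = 0 := by
  simp [innerFaces]

theorem map_innerFaces {M N : Type*} [AddCommGroup M] [AddCommGroup N] {n : ℕ} (φ : M →+ N)
    (f : (Fin n → S) → M) (r : Fin (n + 1) → S) :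
    φ (innerFaces f r) = innerFaces (fun q => φ (f q)) r := by
  simp [innerFaces]

/-- The first contraction merges `x` with `r 0`; every other face acts on `r` alone with its index
shifted by one, which flips the sign. -/
theorem innerFaces_cons {M : Type*} [AddCommGroup M] {n : ℕ} (f : (Fin (n + 1) → S) → M) (x : S)
    (r : Fin (n + 1) → S) :
    innerFaces f (Fin.cons x r : Fin (n + 2) → S) =
      - f (Fin.cons (x * r 0) (Fin.tail r)) - innerFaces (fun q => f (Fin.cons x q)) r := by
  have h0 : Fin.contractNth (Fin.castSucc (0 : Fin (n + 1))) (· * ·)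
      (Fin.cons x r : Fin (n + 2) → S) = Fin.cons (x * r 0) (Fin.tail r) := by
    funext k
    refine Fin.cases ?_ (fun k => ?_) k
    · rfl
    · simp [Fin.contractNth, Fin.tail]
  have hs : ∀ j : Fin n, Fin.contractNth (Fin.castSucc j.succ) (· * ·)
      (Fin.cons x r : Fin (n + 2) → S) =
        Fin.cons x (Fin.contractNth j.castSucc (· * ·) r) := by
    intro j
    funext k
    refine Fin.cases ?_ (fun k => ?_) k
    · rfl
    · simp [Fin.contractNth]
  have hi : Fin.init (Fin.cons x r : Fin (n + 2) → S) = Fin.cons x (Fin.init r) := by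
    funext k
    refine Fin.cases ?_ (fun k => ?_) k
    · rfl
    · simp [Fin.init]
  simp only [innerFaces, Fin.sum_univ_succ, h0, hs, hi, Fin.val_zero, Fin.val_succ,
    pow_succ _ (_ + 1), mul_neg, mul_one, neg_smul, Finset.sum_neg_distrib]
  simp
  abel

variable [ZeroModule S A]

variable (A) in
/-- The action of `s`, extended by `0` to `s = 0`. -/
noncomputable def actZero (s : S) : A →+ A :=
  open Classical in if h : s ≠ 0 then ZeroModule.actHom A ⟨s, h⟩ else 0

theorem actZero_mul {x y : S} (h : x * y ≠ 0) (c : A) :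
    actZero A y (actZero A x c) = actZero A (x * y) c := by
  rw [actZero, actZero, actZero, dif_pos h, dif_pos (left_ne_zero_of_mul' h),
    dif_pos (right_ne_zero_of_mul' h)]
  exact ZeroModule.act_act c ⟨x, _⟩ ⟨y, _⟩ h

theorem zeroBoundary_barSymbol {n : ℕ} {x : S} {r : Fin n → S}
    (h : tupleProd (Fin.cons x r : Fin (n + 1) → S) ≠ ((0 : S) : WithOne S)) (c : A) :
    zeroBoundary S A n (barSymbol A (Fin.cons x r : Fin (n + 1) → S) c) =
      barSymbol A r (actZero A x c)
        + innerFaces (fun q => barSymbol A q c) (Fin.cons x r : Fin (n + 1) → S) := by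
  have hx : x ≠ 0 := fun h' => h (by rw [tupleProd_cons, h', withOne_coe_zero_mul'])
  rw [barSymbol_of_ne h, zeroBoundary_single, add_assoc]
  simp only [barSymbol_eq_single]
  rw [actZero, dif_pos hx]
  rfl

theorem zeroBoundary_barSymbol_cons {n : ℕ} {x : S} {r : Fin (n + 1) → S}
    (h : tupleProd (Fin.cons x r : Fin (n + 2) → S) ≠ ((0 : S) : WithOne S)) (c : A) :
    zeroBoundary S A (n + 1) (barSymbol A (Fin.cons x r : Fin (n + 2) → S) c) =
      barSymbol A r (actZero A x c) - barSymbol A (Fin.cons (x * r 0) (Fin.tail r)) c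
        - innerFaces (fun q => barSymbol A (Fin.cons x q : Fin (n + 1) → S) c) r := by
  rw [zeroBoundary_barSymbol h, innerFaces_cons]
  abel

/-! ### The contracting homotopy -/

variable {len : S → ℕ}

open Classical in
/-- The value of the homotopy on `[s, r_1, …, r_n]`: if `s = x_1 ⋯ x_k` with indecomposable `x_i`,
it is the sum of the `- c x_1 ⋯ x_{i-1} [x_i, x_{i+1} ⋯ x_k, r_1, …, r_n]` for `i < k`. -/
noncomputable def splitSum (hl : IsZeroFree len) {n : ℕ} (s : S) (r : Fin n → S) :
    A →+ ZeroChain S A (n + 2) :=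
  if h : s ≠ 0 ∧ ¬ IsIndecomposable s then
    - barSymbol A (Fin.cons (hl.exists_split s h.1 h.2).choose
        (Fin.cons (hl.exists_split s h.1 h.2).choose_spec.choose r : Fin (n + 1) → S))
      + (splitSum hl (hl.exists_split s h.1 h.2).choose_spec.choose r).comp
        (actZero A (hl.exists_split s h.1 h.2).choose)
  else 0
termination_by len s
decreasing_by exact (hl.exists_split s h.1 h.2).choose_spec.choose_spec.2.2

theorem splitSum_of_isIndecomposable (hl : IsZeroFree len) {n : ℕ} {s : S}
    (hs : IsIndecomposable s) (r : Fin n → S) (c : A) : splitSum hl s r c = 0 := by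
  rw [splitSum, dif_neg (fun h => h.2 hs)]; rfl

/-- Unique splitting makes the factors chosen in the definition equal to `x` and `t`, so one step of
the recursion can be read off any factorization with indecomposable left factor. -/
theorem splitSum_mul (hl : IsZeroFree len) {n : ℕ} {x t : S} (hx : IsIndecomposable x)
    (h0 : x * t ≠ 0) (r : Fin n → S) (c : A) :
    splitSum hl (x * t) r c =
      - barSymbol A (Fin.cons x (Fin.cons t r : Fin (n + 1) → S) : Fin (n + 2) → S) c
        + splitSum hl t r (actZero A x c) := by
  have hd : ¬ IsIndecomposable (x * t) := fun h => h.2 x t rfl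
  have hsp := (hl.exists_split _ h0 hd).choose_spec.choose_spec
  obtain ⟨h1, h2⟩ := hl.split_unique _ _ _ _ hx hsp.1 hsp.2.1 h0
  rw [splitSum, dif_pos ⟨h0, hd⟩]
  rw [← h2, ← h1]
  rfl

/-- The contracting homotopy. -/
noncomputable def splitHomotopy (hl : IsZeroFree len) (n : ℕ) :
    ZeroChain S A (n + 1) →+ ZeroChain S A (n + 2) :=
  Finsupp.liftAddHom fun s => splitSum hl (s.1 0) (Fin.tail s.1)

theorem splitHomotopy_barSymbol (hl : IsZeroFree len) {n : ℕ} {s : Fin (n + 1) → S}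
    (h : tupleProd s ≠ ((0 : S) : WithOne S)) (c : A) :
    splitHomotopy hl n (barSymbol A s c) = splitSum hl (s 0) (Fin.tail s) c := by
  rw [barSymbol_of_ne h, splitHomotopy, Finsupp.liftAddHom_apply_single]
  rfl

theorem splitHomotopy_zeroBoundary (hl : IsZeroFree len) {n : ℕ} {x : S} {r : Fin (n + 1) → S}
    (h : tupleProd (Fin.cons x r : Fin (n + 2) → S) ≠ ((0 : S) : WithOne S)) (c : A) :
    splitHomotopy hl n (zeroBoundary S A (n + 1)
        (barSymbol A (Fin.cons x r : Fin (n + 2) → S) c)) =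
      splitSum hl (r 0) (Fin.tail r) (actZero A x c) - splitSum hl (x * r 0) (Fin.tail r) c
        - innerFaces (fun q => splitSum hl x q c) r := by
  have hr : tupleProd r ≠ ((0 : S) : WithOne S) := by
    rw [tupleProd_cons] at h
    exact right_ne_zero_of_withOne_mul h
  have hxr : tupleProd (Fin.cons (x * r 0) (Fin.tail r) : Fin (n + 1) → S) ≠
      ((0 : S) : WithOne S) := by
    rw [tupleProd_cons_mul]
    exact (Fin.cons_self_tail r).symm ▸ h
  rw [zeroBoundary_barSymbol_cons h, map_sub, map_sub, splitHomotopy_barSymbol hl hr,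
    splitHomotopy_barSymbol hl hxr, map_innerFaces]
  congr 1
  -- These faces leave the first entry `x` unchanged, so the homotopy splits the same element in
  -- each.
  exact innerFaces_congr h fun q hq => splitHomotopy_barSymbol hl hq c

/-- If `x` is indecomposable, `h` kills all symbols starting with `x`, and the symbol itself comes
from splitting `x * r 0`. If `x = y * t`, then `h (c [x, r]) = - c [y, t, r] + h (c y [t, r])`; the
boundary of `c [y, t, r]` accounts for the difference from the identity for `c y [t, r]`. -/
theorem homotopy_barSymbol (hl : IsZeroFree len) {n : ℕ} (x : S) (r : Fin (n + 1) → S)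
    (h : tupleProd (Fin.cons x r : Fin (n + 2) → S) ≠ ((0 : S) : WithOne S)) (c : A) :
    zeroBoundary S A (n + 2) (splitHomotopy hl (n + 1)
        (barSymbol A (Fin.cons x r : Fin (n + 2) → S) c))
      + splitHomotopy hl n (zeroBoundary S A (n + 1)
        (barSymbol A (Fin.cons x r : Fin (n + 2) → S) c)) =
      barSymbol A (Fin.cons x r : Fin (n + 2) → S) c := by
  induction hk : len x using Nat.strong_induction_on generalizing x c with
  | _ k ih =>
  have hxr : x * r 0 ≠ 0 := by
    intro h'
    rw [tupleProd_cons, tupleProd_succ, ← mul_assoc, ← WithOne.coe_mul, h',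
      withOne_coe_zero_mul'] at h
    exact h rfl
  rw [splitHomotopy_zeroBoundary hl h, splitHomotopy_barSymbol hl h, Fin.cons_zero, Fin.tail_cons]
  by_cases hx : IsIndecomposable x
  · rw [splitSum_mul hl hx hxr, splitSum_of_isIndecomposable hl hx, Fin.cons_self_tail]
    simp only [splitSum_of_isIndecomposable hl hx, innerFaces_zero, map_zero]
    abel
  · have hx0 := left_ne_zero_of_mul' hxr
    obtain ⟨y, t, hy, rfl, hlt⟩ := hl.exists_split x hx0 hx
    have hyt := h
    rw [tupleProd_cons_mul] at hyt
    have ht : tupleProd (Fin.cons t r : Fin (n + 2) → S) ≠ ((0 : S) : WithOne S) := by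
      rw [tupleProd_cons] at hyt
      exact right_ne_zero_of_withOne_mul hyt
    -- The coefficient becomes `c y`, which is why the induction generalizes `c`.
    have key := ih (len t) (hk ▸ hlt) t ht (actZero A y c) rfl
    rw [splitHomotopy_zeroBoundary hl ht, splitHomotopy_barSymbol hl ht, Fin.cons_zero,
      Fin.tail_cons, actZero_mul hx0] at key
    have hb := zeroBoundary_barSymbol_cons hyt c
    rw [innerFaces_cons, Fin.cons_zero, Fin.tail_cons] at hb
    have hassoc : y * (t * r 0) ≠ 0 := by rwa [← mul_assoc]
    simp only [splitSum_mul hl hy hx0, innerFaces_add, innerFaces_neg, map_add, map_neg]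
    rw [mul_assoc, splitSum_mul hl hy hassoc, hb]
    -- Substituting the induction identity for `0` leaves a formal cancellation of symbols.
    rw [← sub_eq_zero] at key ⊢
    rw [← key]
    abel

/-! ### From symbols to chains and homology -/

theorem zeroBoundary_splitHomotopy (hl : IsZeroFree len) {n : ℕ} (z : ZeroChain S A (n + 2)) :
    zeroBoundary S A (n + 2) (splitHomotopy hl (n + 1) z)
      + splitHomotopy hl n (zeroBoundary S A (n + 1) z) = z := by
  induction z using Finsupp.induction_linear with
  | zero => simp
  | add f g hf hg =>
    simp only [map_add]
    -- The third occurrence is the one on the right-hand side.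
    nth_rewrite 3 [← hf]
    nth_rewrite 3 [← hg]
    abel
  | single s c =>
    have h := homotopy_barSymbol hl (s.1 0) (Fin.tail s.1)
      ((Fin.cons_self_tail s.1).symm ▸ s.2) c
    rw [Fin.cons_self_tail] at h
    rwa [barSymbol_eq_single]

theorem IsZeroFree.subsingleton_zeroHomology (hl : IsZeroFree len) (n : ℕ) :
    Subsingleton (ZeroHomology S A (n + 2)) := by
  have htop : (zeroBoundaries S A (n + 2)).addSubgroupOf (zeroCycles S A (n + 2)) = ⊤ := by
    rw [AddSubgroup.addSubgroupOf_eq_top]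
    intro z hz
    have hz' : zeroBoundary S A (n + 1) z = 0 := hz
    have h := zeroBoundary_splitHomotopy hl z
    rw [hz', map_zero, add_zero] at h
    exact ⟨_, h⟩
  rw [ZeroHomology, htop]
  exact QuotientAddGroup.subsingleton_quotient_top

end Homotopy

theorem mainTheorem5 {ι S A : Type*} [SemigroupWithZero S] [AddCommGroup A] [ZeroModule S A]
    (a : ι → S) (Γ : Set (ι × ι)) (hS : IsZeroPresentation a (ZeroProductRel Γ))
    (n : ℕ) (hn : 1 < n) :
    Subsingleton (ZeroHomology S A n) := by
  obtain ⟨n, rfl⟩ := Nat.exists_eq_add_of_lt hn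
  rw [show 1 + n + 1 = n + 2 by omega]
  exact hS.isZeroFree.subsingleton_zeroHomology n
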